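/- Let $N\ge 0$ be an integer and let $A\in SL(N,\mathbb Z)$ be a matrix with at least one complex eigenvalue that does not lie on the unit circle. Let $G=\mathbb Z^N\rtimes_A\mathbb Z$ be the semidirect product in which the generator of the factor $\mathbb Z$ acts on $\mathbb Z^N$ by $x\mapsto Ax$. Then $G$ is not almost convex with respect to any finite generating set $S$. Here, for a finite generating set $S$ of $G$, let $d_S$ be the word metric with respect to $S\cup S^{-1}$, that is, the path metric of the Cayley graph of $G$, in which $g$ and $gs$ are adjacent for $g\in G$ and $s\in S\cup S^{-1}$; let $\beta(n)=\{g\in G: d_S(1,g)\le n\}$ and $\Sigma(n)=\{g\in G: d_S(1,g)=n\}$. The group $G$ is called almost convex with respect to $S$ if for every integer $k\ge 0$ there is an integer $M=M(k)>0$ such that for every $n\ge 0$ and all $g_1,g_2\in\Sigma(n)$ with $d_S(g_1,g_2)\le k$ there is a path from $g_1$ to $g_2$ in the Cayley graph, of length less than $M$, all of whose vertices lie in $\beta(n)$. -/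

import Mathlib

/-- The automorphism `x ↦ A x` of the free abelian group `ℤ^N` (written multiplicatively) given by
a matrix `A ∈ SL(N, ℤ)`. -/
def latticeAut {N : ℕ} (A : Matrix.SpecialLinearGroup (Fin N) ℤ) :
    MulAut (Multiplicative (Fin N → ℤ)) :=
  AddEquiv.toMultiplicative (Matrix.SpecialLinearGroup.toLin' A).toAddEquiv

/-- The group `ℤ^N ⋊_A ℤ`, in which the integer `m` acts on `ℤ^N` by `x ↦ A ^ m x`, so that
conjugation by the generator of the factor `ℤ` is multiplication by `A`. -/
abbrev TorusBundleGroup {N : ℕ} (A : Matrix.SpecialLinearGroup (Fin N) ℤ) : Type :=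
  Multiplicative (Fin N → ℤ) ⋊[zpowersHom (MulAut (Multiplicative (Fin N → ℤ))) (latticeAut A)]
    Multiplicative ℤ

section AlmostConvex

variable {G : Type*} [Group G]

/-- The word metric on `G` with respect to `S ∪ S⁻¹`: the path metric of the Cayley graph, in which
`g` and `g * s` are joined by an edge for all `g ∈ G` and `s ∈ S ∪ S⁻¹` with `g * s ≠ g`. -/
noncomputable def wordDist (S : Set G) (g h : G) : ℕ :=
  (SimpleGraph.mulCayley S).dist g h

/-- The ball of radius `n` about the identity in the word metric. -/
def wordBall (S : Set G) (n : ℕ) : Set G :=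
  {g | wordDist S 1 g ≤ n}

/-- The sphere of radius `n` about the identity in the word metric. -/
def wordSphere (S : Set G) (n : ℕ) : Set G :=
  {g | wordDist S 1 g = n}

/-- The pair `(G, S)` is `AC(k)`: there is a constant `M > 0` such that, for every `n`, any two
elements of the sphere of radius `n` at distance at most `k` from one another are joined by a path
of length less than `M` in the Cayley graph all of whose vertices are in the ball of radius `n`. -/
def IsAlmostConvexWith (S : Set G) (k : ℕ) : Prop :=
  ∃ M : ℕ, 0 < M ∧ ∀ n : ℕ, ∀ g ∈ wordSphere S n, ∀ h ∈ wordSphere S n, wordDist S g h ≤ k →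
    ∃ p : (SimpleGraph.mulCayley S).Walk g h, p.length < M ∧ ∀ v ∈ p.support, v ∈ wordBall S n

/-- The pair `(G, S)` is almost convex: it is `AC(k)` for every `k`. -/
def IsAlmostConvex (S : Set G) : Prop :=
  ∀ k : ℕ, IsAlmostConvexWith S k

end AlmostConvex

/-! Since `det A = 1`, an eigenvalue off the unit circle forces eigenvalues `lam`, `mu` with `‖lam‖
> 1 > ‖mu‖`. Left eigenvectors give cocycles `Φ` and `Ψ` on the group, one expanding upwards and one
downwards in the height. Let `t` be a generator or inverse generator of maximal height `K`, and take
`a`, `b` of height 0 with `Φ a ≠ 0`, `Ψ b ≠ 0`. Then `x = t ^ m * a * t ^ (-m)` and `y = t ^ (-m) *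
b * t ^ m` commute.

For large `m`, `Φ` and `Ψ` are of order `‖lam‖ ^ (K * m)` and `‖mu‖ ^ (-K * m)` on `x * y`. A path
there must climb to height about `m * K`, descend to about `-m * K` and return, so its length is at
least `4 * m - L` with `L` independent of `m` (`exists_forall_length_ge`). A naive count loses `log
m`; the loss disappears because lingering near an extreme lengthens the path.

Since `x * y = y * x`, either excursion may come last and be cut short by `j` steps, so `x * y * t ^
j` and `x * y * t ^ (-j)` lie in the ball of radius `4 * m - j + c₀`. For `j > L + c₀`, `x * y` lies
outside this ball, and so, for `m` large, does every element of height at most `K` in absolute value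
within a fixed distance of it. A short path in the ball between the two sides would have to pass
through such an element (`not_isAlmostConvex_of_cocycles`). -/

/-! ### Exponential sums along paths of heights -/

theorem sum_rpow_le_of_injOn {R : ℝ} (hR : 1 < R) (T : Finset ℕ) (z : ℕ → ℝ) (k : ℕ → ℕ)
    (hk : Set.InjOn k T) (hz : ∀ i ∈ T, z i ≤ -(k i : ℝ)) :
    ∑ i ∈ T, R ^ z i ≤ (1 - R⁻¹)⁻¹ := by
  have hR0 : 0 < R := by linarith
  have hlt : R⁻¹ < 1 := inv_lt_one_of_one_lt₀ hR
  calc ∑ i ∈ T, R ^ z i ≤ ∑ i ∈ T, R⁻¹ ^ k i := by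
        refine Finset.sum_le_sum fun i hi => ?_
        calc R ^ z i ≤ R ^ (-(k i : ℝ)) := Real.rpow_le_rpow_of_exponent_le hR.le (hz i hi)
          _ = R⁻¹ ^ k i := by rw [Real.rpow_neg hR0.le, Real.rpow_natCast, inv_pow]
    _ = ∑ j ∈ T.image k, R⁻¹ ^ j := (Finset.sum_image hk).symm
    _ ≤ ∑' j, R⁻¹ ^ j := Summable.sum_le_tsum _ (fun j _ => by positivity)
        (summable_geometric_of_lt_one (by positivity) hlt)
    _ = (1 - R⁻¹)⁻¹ := tsum_geometric_of_lt_one (by positivity) hlt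

theorem sum_rpow_le_of_le_add {R : ℝ} (hR : 1 < R) (T : Finset ℕ) (z : ℕ → ℝ) (p : ℝ)
    (hz : ∀ i ∈ T, z i ≤ p + i ∧ p + i ≤ 0) :
    ∑ i ∈ T, R ^ z i ≤ (1 - R⁻¹)⁻¹ := by
  have key : ∀ i ∈ T, ((⌊-(p + i)⌋₊ : ℕ) : ℤ) = ⌊-p⌋ - i := fun i hi => by
    rw [Int.natCast_floor_eq_floor (by linarith [(hz i hi).2]), neg_add, ← sub_eq_add_neg,
      Int.floor_sub_natCast]
  refine sum_rpow_le_of_injOn hR T z (fun i => ⌊-(p + i)⌋₊) (fun i hi j hj hij => ?_)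
    fun i hi => ?_
  · have h1 := key i hi
    have h2 := key j hj
    simp only at hij
    omega
  · linarith [(hz i hi).1, Nat.floor_le (show 0 ≤ -(p + i) by linarith [(hz i hi).2])]

theorem sum_rpow_le_of_le_sub {R : ℝ} (hR : 1 < R) (T : Finset ℕ) (z : ℕ → ℝ) (q : ℝ)
    (hz : ∀ i ∈ T, z i ≤ q - i ∧ q - i ≤ 0) :
    ∑ i ∈ T, R ^ z i ≤ (1 - R⁻¹)⁻¹ := by
  have key : ∀ i ∈ T, ((⌊-(q - i)⌋₊ : ℕ) : ℤ) = ⌊-q⌋ + i := fun i hi => by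
    rw [Int.natCast_floor_eq_floor (by linarith [(hz i hi).2]),
      show -(q - i) = -q + (i : ℝ) by ring, Int.floor_add_natCast]
  refine sum_rpow_le_of_injOn hR T z (fun i => ⌊-(q - i)⌋₊) (fun i hi j hj hij => ?_)
    fun i hi => ?_
  · have h1 := key i hi
    have h2 := key j hj
    simp only at hij
    omega
  · linarith [(hz i hi).1, Nat.floor_le (show 0 ≤ -(q - i) by linarith [(hz i hi).2])]

theorem card_le_of_forall_mem_Icc (T : Finset ℕ) {a b : ℝ} (hT : ∀ i ∈ T, a ≤ i ∧ (i : ℝ) ≤ b) :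
    (T.card : ℝ) ≤ max 0 (b - a) + 1 := by
  rcases T.eq_empty_or_nonempty with rfl | ⟨i, hi⟩
  · simp only [Finset.card_empty, Nat.cast_zero]
    positivity
  have hab : a ≤ b := (hT i hi).1.trans (hT i hi).2
  have hb : 0 ≤ b := (Nat.cast_nonneg i).trans (hT i hi).2
  have hsub : T ⊆ Finset.Icc ⌈a⌉₊ ⌊b⌋₊ := fun j hj =>
    Finset.mem_Icc.2 ⟨Nat.ceil_le.2 (hT j hj).1, Nat.le_floor (hT j hj).2⟩
  have hcard := Finset.card_le_card hsub
  have hmem := Finset.mem_Icc.1 (hsub hi)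
  rw [Nat.card_Icc] at hcard
  have h : T.card + ⌈a⌉₊ ≤ ⌊b⌋₊ + 1 := by omega
  have h' : (T.card : ℝ) + ⌈a⌉₊ ≤ ⌊b⌋₊ + 1 := by exact_mod_cast h
  linarith [Nat.le_ceil a, Nat.floor_le hb, le_max_right 0 (b - a)]

/-- A sum of exponentials whose exponents lie under a trapezoid with sides of slope `±1`. -/
theorem sum_rpow_le_of_trapezoid {R : ℝ} (hR : 1 < R) (T : Finset ℕ) (z : ℕ → ℝ) (u p q : ℝ)
    (hz : ∀ i ∈ T, z i ≤ u ∧ z i ≤ p + i ∧ z i ≤ q - i) :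
    ∑ i ∈ T, R ^ (z i - u) ≤ max 0 (q + p - 2 * u) + (1 + 2 * (1 - R⁻¹)⁻¹) := by
  -- Each sloping side is dominated by a geometric series; on the flat top every term is at most 1,
  -- so its width is the bound.
  rw [← Finset.sum_filter_add_sum_filter_not T (fun i : ℕ => p + i - u ≤ 0),
    ← Finset.sum_filter_add_sum_filter_not (T.filter fun i : ℕ => ¬ p + i - u ≤ 0)
      (fun i : ℕ => q - u - i ≤ 0)]
  have h1 : ∑ i ∈ T.filter (fun i : ℕ => p + i - u ≤ 0), R ^ (z i - u) ≤ (1 - R⁻¹)⁻¹ := by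
    refine sum_rpow_le_of_le_add hR _ _ (p - u) fun i hi => ?_
    obtain ⟨hi, hi'⟩ := Finset.mem_filter.1 hi
    constructor <;> linarith [(hz i hi).2.1]
  have h2 : ∑ i ∈ (T.filter fun i : ℕ => ¬ p + i - u ≤ 0).filter (fun i : ℕ => q - u - i ≤ 0),
      R ^ (z i - u) ≤ (1 - R⁻¹)⁻¹ := by
    refine sum_rpow_le_of_le_sub hR _ _ (q - u) fun i hi => ?_
    obtain ⟨hi, hi'⟩ := Finset.mem_filter.1 hi
    constructor <;> linarith [(hz i (Finset.mem_filter.1 hi).1).2.2]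
  have h3 : ∑ i ∈ (T.filter fun i : ℕ => ¬ p + i - u ≤ 0).filter (fun i : ℕ => ¬ q - u - i ≤ 0),
      R ^ (z i - u) ≤ max 0 (q + p - 2 * u) + 1 := by
    refine (Finset.sum_le_card_nsmul _ _ 1 fun i hi => ?_).trans ?_
    · obtain ⟨hi, hi'⟩ := Finset.mem_filter.1 hi
      exact Real.rpow_le_one_of_one_le_of_nonpos hR.le
        (by linarith [(hz i (Finset.mem_filter.1 hi).1).1])
    · rw [nsmul_eq_mul, mul_one, show q + p - 2 * u = (q - u) - (u - p) by ring]
      refine card_le_of_forall_mem_Icc _ fun i hi => ?_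
      simp only [Finset.mem_filter, not_le] at hi
      constructor <;> linarith
  linarith

theorem abs_sub_le_of_abs_succ_sub_le_one {y : ℕ → ℝ} (hy : ∀ i, |y (i + 1) - y i| ≤ 1) {i j : ℕ}
    (hij : i ≤ j) : |y j - y i| ≤ j - i := by
  induction j, hij using Nat.le_induction with
  | base => simp
  | succ j hij ih =>
    push_cast
    calc |y (j + 1) - y i| ≤ |y (j + 1) - y j| + |y j - y i| := abs_sub_le _ _ _
      _ ≤ j + 1 - i := by linarith [hy j]

/-- `n + 1 - 2 * u - 2 * d` is the excess of the path over the shortest tour of the heights `u` and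
`-d`; the `1` allows for the final height. Cutting at the time `l` of the minimum puts each half
under a trapezoid whose flat top is no wider than the excess. -/
theorem sum_rpow_path_le {R : ℝ} (hR : 1 < R) {y : ℕ → ℝ} (hy : ∀ i, |y (i + 1) - y i| ≤ 1)
    (hy0 : y 0 = 0) {n : ℕ} (hyn : |y n| ≤ 1) {u d : ℝ} (hu : ∀ i ≤ n, y i ≤ u) {k l : ℕ}
    (hk : k ≤ n) (hku : y k = u) (hl : l ≤ n) (hld : y l = -d) :
    0 ≤ n + 1 - 2 * u - 2 * d ∧
      ∑ i ∈ Finset.range n, R ^ (y i - u) ≤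
        2 * ((n + 1 - 2 * u - 2 * d) + (1 + 2 * (1 - R⁻¹)⁻¹)) := by
  have lip : ∀ {i j : ℕ}, i ≤ j → y j - y i ≤ j - i ∧ y i - y j ≤ j - i := fun hij =>
    ⟨(abs_le.1 (abs_sub_le_of_abs_succ_sub_le_one hy hij)).2,
      by linarith [(abs_le.1 (abs_sub_le_of_abs_succ_sub_le_one hy hij)).1]⟩
  obtain ⟨hyn1, hyn2⟩ := abs_le.1 hyn
  have hl0 := lip (Nat.zero_le l)
  have hln := lip hl
  rw [hy0] at hl0
  rw [hld] at hl0 hln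
  push_cast at hl0
  have hE : 0 ≤ n + 1 - 2 * u - 2 * d := by
    have hk0 := lip (Nat.zero_le k)
    have hkn := lip hk
    rw [hy0] at hk0
    rw [hku] at hk0 hkn
    push_cast at hk0
    rcases le_total k l with h | h
    · have := lip h
      rw [hku, hld] at this
      linarith
    · have := lip h
      rw [hku, hld] at this
      linarith
  refine ⟨hE, ?_⟩
  rw [← Finset.sum_filter_add_sum_filter_not (Finset.range n) (fun i : ℕ => i ≤ l)]
  have h1 := sum_rpow_le_of_trapezoid hR ((Finset.range n).filter fun i : ℕ => i ≤ l) y u 0 (l - d)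
    fun i hi => by
      simp only [Finset.mem_filter, Finset.mem_range] at hi
      have ha := lip (Nat.zero_le i)
      have hb := lip hi.2
      rw [hy0] at ha
      rw [hld] at hb
      push_cast at ha
      exact ⟨hu i hi.1.le, by linarith, by linarith⟩
  have h2 := sum_rpow_le_of_trapezoid hR ((Finset.range n).filter fun i : ℕ => ¬ i ≤ l) y u
    (-d - l) (n + 1) fun i hi => by
      simp only [Finset.mem_filter, Finset.mem_range, not_le] at hi
      have ha := lip hi.2.le
      have hb := lip hi.1.le
      rw [hld] at ha
      exact ⟨hu i hi.1.le, by linarith, by linarith⟩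
  have m1 : max 0 (l - d + 0 - 2 * u) ≤ n + 1 - 2 * u - 2 * d := max_le hE (by linarith)
  have m2 : max 0 (n + 1 + (-d - l) - 2 * u) ≤ n + 1 - 2 * u - 2 * d := max_le hE (by linarith)
  linarith

/-- A logarithm lies below a line of any positive slope. Slope `1 / 8` suffices later: any slope up
to `1 / 4` lets the excess absorb the error. -/
theorem exists_forall_le_of_rpow_le {R c : ℝ} (hR : 1 < R) (hc : 0 < c) (C : ℝ) :
    ∃ L : ℝ, ∀ E z : ℝ, c * R ^ z ≤ 2 * (E + C) → z ≤ E / 8 + L := by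
  have hR0 : 0 < R := by linarith
  have hlog : 0 < Real.log R := Real.log_pos hR
  set ε := c * Real.log R / 16 with hε
  have hε0 : 0 < ε := by positivity
  refine ⟨C / 8 + (-1 - Real.log ε) / Real.log R, fun E z h => ?_⟩
  have hz : 0 < R ^ z := Real.rpow_pos_of_pos hR0 z
  have h1 := Real.log_le_sub_one_of_pos (mul_pos hε0 hz)
  rw [Real.log_mul hε0.ne' hz.ne', Real.log_rpow hR0] at h1
  have h2 : ε * R ^ z ≤ Real.log R / 8 * (E + C) := by
    calc ε * R ^ z = Real.log R / 16 * (c * R ^ z) := by rw [hε]; ring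
      _ ≤ Real.log R / 16 * (2 * (E + C)) := by gcongr
      _ = _ := by ring
  have h3 : z * Real.log R ≤ (E / 8 + (C / 8 + (-1 - Real.log ε) / Real.log R)) * Real.log R := by
    have : (-1 - Real.log ε) / Real.log R * Real.log R = -1 - Real.log ε :=
      div_mul_cancel₀ _ hlog.ne'
    linarith
  exact le_of_mul_le_mul_right h3 hlog

/-- A path of heights with steps at most `1` from height `0` to nearly height `0` whose exponential
sums in both directions are of size `R ^ m` and `Q ^ m` has length at least `4 * m - L`. -/
theorem exists_forall_length_ge {R Q c c' : ℝ} (hR : 1 < R) (hQ : 1 < Q) (hc : 0 < c)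
    (hc' : 0 < c') :
    ∃ L : ℝ, ∀ (y : ℕ → ℝ) (n : ℕ) (m : ℝ), (∀ i, |y (i + 1) - y i| ≤ 1) → y 0 = 0 → |y n| ≤ 1 →
      c * R ^ m ≤ ∑ i ∈ Finset.range n, R ^ y i → c' * Q ^ m ≤ ∑ i ∈ Finset.range n, Q ^ (-y i) →
      4 * m - L ≤ n := by
  obtain ⟨L₁, hL₁⟩ := exists_forall_le_of_rpow_le hR hc (1 + 2 * (1 - R⁻¹)⁻¹)
  obtain ⟨L₂, hL₂⟩ := exists_forall_le_of_rpow_le hQ hc' (1 + 2 * (1 - Q⁻¹)⁻¹)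
  refine ⟨2 * (L₁ + L₂) + 1, fun y n m hy hy0 hyn hsR hsQ => ?_⟩
  obtain ⟨k, hk, hkmax⟩ := Finset.exists_max_image (Finset.range (n + 1)) y ⟨0, by simp⟩
  obtain ⟨l, hl, hlmin⟩ := Finset.exists_min_image (Finset.range (n + 1)) y ⟨0, by simp⟩
  simp only [Finset.mem_range, Nat.lt_succ_iff] at hk hkmax hl hlmin
  obtain ⟨hE, h1⟩ := sum_rpow_path_le (d := -y l) hR hy hy0 hyn hkmax hk rfl hl (by simp)
  have hny : ∀ i, |-y (i + 1) - -y i| ≤ 1 := fun i => by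
    rw [neg_sub_neg, abs_sub_comm]; exact hy i
  -- Reflecting the path exchanges the two extremes and leaves the excess unchanged.
  obtain ⟨-, h2⟩ := sum_rpow_path_le (y := fun i => -y i) (u := -y l) (d := y k) hQ hny (by simp [hy0])
    (by simpa using hyn) (fun i hi => neg_le_neg (hlmin i hi)) hl rfl hk rfl
  have scale : ∀ {B b : ℝ} {f : ℕ → ℝ} (u : ℝ), 1 < B →
      b * B ^ m ≤ ∑ i ∈ Finset.range n, B ^ f i →
      b * B ^ (m - u) ≤ ∑ i ∈ Finset.range n, B ^ (f i - u) := fun {B b f} u hB h => by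
    have hB0 : 0 < B := by linarith
    simp only [Real.rpow_sub hB0, ← Finset.sum_div, ← mul_div_assoc]
    exact div_le_div_of_nonneg_right h (Real.rpow_pos_of_pos hB0 u).le
  have e1 := hL₁ _ _ ((scale (y k) hR hsR).trans h1)
  have e2 := hL₂ _ _ ((scale (-y l) hQ hsQ).trans h2)
  -- With `E` the excess, `e1` and `e2` give `4 * m ≤ (n + 1 - E) + E / 2 + 2 * (L₁ + L₂)`, and `E ≥
  -- 0`.
  linarith

/-! ### The word metric -/

section WordMetric

variable {G : Type*} [Group G] {S : Set G}

theorem mulCayley_connected (hgen : Subgroup.closure S = ⊤) :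
    (SimpleGraph.mulCayley S).Connected := by
  have key : ∀ x ∈ Subgroup.closure S, ∀ g : G, (SimpleGraph.mulCayley S).Reachable g (g * x) := by
    intro x hx
    induction hx using Subgroup.closure_induction with
    | mem s hs =>
      intro g
      by_cases h : g = g * s
      · rw [← h]
      · exact ((SimpleGraph.mulCayley_adj S _ _).2 ⟨h, Or.inl (by simpa using hs)⟩).reachable
    | one => simp
    | mul x y _ _ hx hy => exact fun g => (hx g).trans (by simpa [mul_assoc] using hy (g * x))
    | inv x _ hx => exact fun g => by simpa using (hx (g * x⁻¹)).symm
  refine SimpleGraph.connected_iff _ |>.2 ⟨fun u v => ?_, ⟨1⟩⟩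
  simpa using key (u⁻¹ * v) (by rw [hgen]; trivial) u

theorem wordDist_triangle (hgen : Subgroup.closure S = ⊤) (u v w : G) :
    wordDist S u w ≤ wordDist S u v + wordDist S v w :=
  (mulCayley_connected hgen).dist_triangle

theorem wordDist_comm (u v : G) : wordDist S u v = wordDist S v u :=
  SimpleGraph.dist_comm

theorem wordDist_mul_left (hgen : Subgroup.closure S = ⊤) (g u v : G) :
    wordDist S (g * u) (g * v) = wordDist S u v := by
  have key : ∀ g u v : G, wordDist S (g * u) (g * v) ≤ wordDist S u v := by
    intro g u v
    obtain ⟨p, hp⟩ := (mulCayley_connected hgen).exists_walk_length_eq_dist u v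
    let f : SimpleGraph.mulCayley S →g SimpleGraph.mulCayley S :=
      ⟨fun x => g * x, fun h => SimpleGraph.mulCayley_adj_mul_iff_right.2 h⟩
    calc wordDist S (g * u) (g * v) ≤ (p.map f).length := SimpleGraph.dist_le (p.map f)
      _ = wordDist S u v := by rw [SimpleGraph.Walk.length_map, hp]; rfl
  refine le_antisymm (key g u v) ?_
  simpa using key g⁻¹ (g * u) (g * v)

theorem wordDist_eq_one_left (hgen : Subgroup.closure S = ⊤) (u v : G) :
    wordDist S u v = wordDist S 1 (u⁻¹ * v) := by
  rw [← wordDist_mul_left hgen u⁻¹ u v, inv_mul_cancel]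

theorem wordDist_one_mul_le (hgen : Subgroup.closure S = ⊤) (g h : G) :
    wordDist S 1 (g * h) ≤ wordDist S 1 g + wordDist S 1 h := by
  refine (wordDist_triangle hgen 1 g (g * h)).trans_eq ?_
  rw [wordDist_eq_one_left hgen g, inv_mul_cancel_left]

theorem wordDist_one_inv (hgen : Subgroup.closure S = ⊤) (g : G) :
    wordDist S 1 g⁻¹ = wordDist S 1 g := by
  rw [wordDist_comm, wordDist_eq_one_left hgen, inv_inv, mul_one]

theorem wordDist_one_pow_le (hgen : Subgroup.closure S = ⊤) {t : G} (ht : wordDist S 1 t ≤ 1)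
    (m : ℕ) : wordDist S 1 (t ^ m) ≤ m := by
  induction m with
  | zero => simp [wordDist]
  | succ m ih =>
    rw [pow_succ]
    exact (wordDist_one_mul_le hgen _ _).trans (add_le_add ih ht)

theorem wordDist_one_le_one {s : G} (hs : s ∈ S) : wordDist S 1 s ≤ 1 := by
  by_cases h : 1 = s
  · simp [wordDist, ← h]
  · exact (SimpleGraph.dist_eq_one_iff_adj.2
      ((SimpleGraph.mulCayley_adj S _ _).2 ⟨h, Or.inl (by simpa using hs)⟩)).le

theorem walk_step_mem {u v : G} (p : (SimpleGraph.mulCayley S).Walk u v) (i : ℕ) :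
    (p.getVert i)⁻¹ * p.getVert (i + 1) ∈ insert 1 (S ∪ S⁻¹) := by
  rcases lt_or_ge i p.length with h | h
  · rcases ((SimpleGraph.mulCayley_adj S _ _).1 (p.adj_getVert_succ h)).2 with h | h
    · exact Or.inr (Or.inl h)
    · exact Or.inr (Or.inr (by simpa using h))
  -- Past its end the walk stays put, which is why `1` is among the allowed steps.
  · rw [p.getVert_of_length_le h, p.getVert_of_length_le (by omega)]
    simp

/-- Every element at distance `n` is the endpoint of a path of `n` steps. -/
theorem exists_path (hgen : Subgroup.closure S = ⊤) (v : G) :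
    ∃ γ : ℕ → G, γ 0 = 1 ∧ γ (wordDist S 1 v) = v ∧
      ∀ i, (γ i)⁻¹ * γ (i + 1) ∈ insert 1 (S ∪ S⁻¹) := by
  obtain ⟨p, hp⟩ := (mulCayley_connected hgen).exists_walk_length_eq_dist 1 v
  refine ⟨p.getVert, p.getVert_zero, ?_, walk_step_mem p⟩
  rw [wordDist, ← hp, p.getVert_length]

theorem wordDist_getVert_le {u v : G} (p : (SimpleGraph.mulCayley S).Walk u v) (i : ℕ) :
    wordDist S u (p.getVert i) ≤ p.length := by
  refine (SimpleGraph.dist_le (p.take i)).trans ?_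
  rw [SimpleGraph.Walk.take_length]
  exact min_le_right _ _

end WordMetric

/-! ### Discrete intermediate values -/

theorem exists_pos_le_eq_of_step {f : ℕ → ℕ} {n j : ℕ} (h0 : n < f 0) (hj : f j ≤ n)
    (hstep : ∀ i, f i ≤ f (i + 1) + 1) : ∃ i, 0 < i ∧ i ≤ j ∧ f i = n := by
  classical
  have hex : ∃ i, f i ≤ n := ⟨j, hj⟩
  have h1 := Nat.find_spec hex
  obtain ⟨i, hi⟩ : ∃ i, Nat.find hex = i + 1 := Nat.exists_eq_succ_of_ne_zero fun h => by
    rw [h] at h1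
    omega
  have h2 := Nat.find_min hex (m := i) (by omega)
  have h3 := hstep i
  have h4 := Nat.find_le (h := hex) hj
  rw [hi] at h1 h4
  exact ⟨i + 1, by omega, h4, by omega⟩

theorem exists_abs_le_of_step {f : ℕ → ℤ} {n : ℕ} {K : ℤ} (h0 : 0 < f 0) (hn : f n < 0)
    (hstep : ∀ i, |f (i + 1) - f i| ≤ K) : ∃ i, |f i| ≤ K := by
  classical
  have hex : ∃ i, f i ≤ 0 := ⟨n, hn.le⟩
  have h1 := Nat.find_spec hex
  obtain ⟨i, hi⟩ : ∃ i, Nat.find hex = i + 1 := Nat.exists_eq_succ_of_ne_zero fun h => by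
    rw [h] at h1
    omega
  have h2 := Nat.find_min hex (m := i) (by omega)
  have h3 := hstep i
  rw [hi] at h1
  refine ⟨i + 1, ?_⟩
  rw [abs_le] at h3 ⊢
  omega

/-! ### Height functions, cocycles and the failure of almost convexity -/

section Cocycle

variable {G : Type*} [Group G] {ht : G → ℤ}

theorem height_one (hht : ∀ g h, ht (g * h) = ht g + ht h) : ht 1 = 0 := by
  have := hht 1 1
  rw [mul_one] at this
  omega

theorem height_inv (hht : ∀ g h, ht (g * h) = ht g + ht h) (g : G) : ht g⁻¹ = -ht g := by
  have := hht g g⁻¹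
  rw [mul_inv_cancel, height_one hht] at this
  omega

theorem height_pow (hht : ∀ g h, ht (g * h) = ht g + ht h) (g : G) (m : ℕ) :
    ht (g ^ m) = m * ht g := by
  induction m with
  | zero => simp [height_one hht]
  | succ m ih => rw [pow_succ, hht, ih]; push_cast; ring

variable {lam : ℂ} {Φ : G → ℂ}

theorem cocycle_one (hht : ∀ g h, ht (g * h) = ht g + ht h)
    (hΦ : ∀ g h, Φ (g * h) = Φ g + lam ^ ht g * Φ h) : Φ 1 = 0 := by
  have := hΦ 1 1
  simpa [height_one hht] using this

theorem cocycle_conj (hht : ∀ g h, ht (g * h) = ht g + ht h)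
    (hΦ : ∀ g h, Φ (g * h) = Φ g + lam ^ ht g * Φ h) (g : G) {a : G} (ha : ht a = 0) :
    Φ (g * a * g⁻¹) = lam ^ ht g * Φ a := by
  have h1 := hΦ g g⁻¹
  rw [mul_inv_cancel, cocycle_one hht hΦ] at h1
  rw [hΦ, hΦ, hht, ha, add_zero]
  linear_combination -h1

/-- The cocycle telescopes along the path, each step being weighted by the current height. Dividing
heights by `K` will make the height steps at most 1. -/
theorem norm_cocycle_le_sum (hlam : 1 < ‖lam‖) (hht : ∀ g h, ht (g * h) = ht g + ht h)
    (hΦ : ∀ g h, Φ (g * h) = Φ g + lam ^ ht g * Φ h) {K : ℕ} (hK : 0 < K) {B : ℝ} {T : Set G}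
    (hB : ∀ s ∈ T, ‖Φ s‖ ≤ B) {γ : ℕ → G} (h0 : γ 0 = 1)
    (hγ : ∀ i, (γ i)⁻¹ * γ (i + 1) ∈ T) (n : ℕ) :
    ‖Φ (γ n)‖ ≤ B * ∑ i ∈ Finset.range n, (‖lam‖ ^ K) ^ ((ht (γ i) : ℝ) / K) := by
  induction n with
  | zero => simp [h0, cocycle_one hht hΦ]
  | succ n ih =>
    have hpow : (‖lam‖ ^ K) ^ ((ht (γ n) : ℝ) / K) = ‖lam‖ ^ ht (γ n) := by
      rw [← Real.rpow_natCast, ← Real.rpow_mul (norm_nonneg _), mul_div_cancel₀ _ (by positivity),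
        Real.rpow_intCast]
    have hstep : Φ (γ (n + 1)) = Φ (γ n) + lam ^ ht (γ n) * Φ ((γ n)⁻¹ * γ (n + 1)) := by
      rw [← hΦ, mul_inv_cancel_left]
    rw [Finset.sum_range_succ, mul_add, hpow, hstep]
    refine (norm_add_le _ _).trans (add_le_add ih ?_)
    rw [norm_mul, norm_zpow, mul_comm]
    exact mul_le_mul_of_nonneg_right (hB _ (hγ n)) (by positivity)

/-- Conjugation by `t ^ m` expands `Φ a`, the opposite conjugation does not expand `Φ b`, and `w`
contributes at most `P`; for large `m` half of the main term survives. -/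
theorem exists_norm_cocycle_ge (hlam : 1 < ‖lam‖) (hht : ∀ g h, ht (g * h) = ht g + ht h)
    (hΦ : ∀ g h, Φ (g * h) = Φ g + lam ^ ht g * Φ h) {K : ℕ} (hK : 0 < K) {t a b : G}
    (htt : ht t = K) (ha : ht a = 0) (hb : ht b = 0) (hΦa : Φ a ≠ 0) (P : ℝ) :
    ∃ m₀ : ℕ, ∀ m ≥ m₀, ∀ w, ‖Φ w‖ ≤ P → ‖Φ a‖ / 2 * (‖lam‖ ^ K) ^ m ≤
      ‖Φ (t ^ m * a * (t ^ m)⁻¹ * ((t ^ m)⁻¹ * b * t ^ m) * w)‖ := by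
  have hR : 1 < ‖lam‖ ^ K := one_lt_pow₀ hlam hK.ne'
  have ha0 : 0 < ‖Φ a‖ := norm_pos_iff.2 hΦa
  obtain ⟨m₀, hm₀⟩ := Filter.eventually_atTop.1
    ((tendsto_pow_atTop_atTop_of_one_lt hR).eventually_ge_atTop ((‖Φ b‖ + P) * 2 / ‖Φ a‖))
  refine ⟨m₀, fun m hm w hw => ?_⟩
  have h1 := hm₀ m hm
  rw [div_le_iff₀ ha0] at h1
  have hb' := cocycle_conj hht hΦ (t ^ m)⁻¹ hb
  rw [inv_inv] at hb'
  have htm : ht (t ^ m) = ((K * m : ℕ) : ℤ) := by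
    rw [height_pow hht, htt]; push_cast; ring
  have hza : ht (t ^ m * a * (t ^ m)⁻¹) = 0 := by
    rw [hht, hht, height_inv hht, ha]; ring
  have hzb : ht ((t ^ m)⁻¹ * b * t ^ m) = 0 := by
    rw [hht, hht, height_inv hht, hb]; ring
  rw [hΦ, hΦ, hht _ (_ * _), hza, hzb, add_zero, zpow_zero, one_mul, one_mul,
    cocycle_conj hht hΦ _ ha, hb', height_inv hht, htm, zpow_neg, zpow_natCast]
  have hn1 : ‖lam ^ (K * m) * Φ a‖ = (‖lam‖ ^ K) ^ m * ‖Φ a‖ := by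
    rw [norm_mul, norm_pow, pow_mul]
  have hn2 : ‖(lam ^ (K * m))⁻¹ * Φ b‖ ≤ ‖Φ b‖ := by
    rw [norm_mul, norm_inv, norm_pow]
    exact mul_le_of_le_one_left (norm_nonneg _) (inv_le_one_of_one_le₀ (one_le_pow₀ hlam.le))
  have h2 : ‖lam ^ (K * m) * Φ a‖ ≤ ‖lam ^ (K * m) * Φ a + (lam ^ (K * m))⁻¹ * Φ b + Φ w‖ +
      (‖(lam ^ (K * m))⁻¹ * Φ b‖ + ‖Φ w‖) := by
    calc ‖lam ^ (K * m) * Φ a‖ = ‖(lam ^ (K * m) * Φ a + (lam ^ (K * m))⁻¹ * Φ b + Φ w) -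
          ((lam ^ (K * m))⁻¹ * Φ b + Φ w)‖ := by congr 1; ring
      _ ≤ _ := (norm_sub_le _ _).trans (add_le_add le_rfl (norm_add_le _ _))
  linarith

theorem exists_norm_cocycle_le (hlam : 1 < ‖lam‖) (hht : ∀ g h, ht (g * h) = ht g + ht h)
    (hΦ : ∀ g h, Φ (g * h) = Φ g + lam ^ ht g * Φ h) {S : Set G}
    (hgen : Subgroup.closure S = ⊤) {K : ℕ} (hK : 0 < K)
    (hKS : ∀ s ∈ insert 1 (S ∪ S⁻¹), |ht s| ≤ K) {B : ℝ} (hB0 : 0 ≤ B)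
    (hB : ∀ s ∈ insert 1 (S ∪ S⁻¹), ‖Φ s‖ ≤ B) (M : ℕ) :
    ∃ P : ℝ, ∀ w, wordDist S 1 w ≤ M → ‖Φ w‖ ≤ P := by
  have hR : 1 ≤ ‖lam‖ ^ K := one_le_pow₀ hlam.le
  refine ⟨B * ∑ i ∈ Finset.range M, (‖lam‖ ^ K) ^ (i : ℝ), fun w hw => ?_⟩
  obtain ⟨γ, h0, hw', hγ⟩ := exists_path hgen w
  have hbound := norm_cocycle_le_sum hlam hht hΦ hK hB h0 hγ (wordDist S 1 w)
  rw [hw'] at hbound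
  refine hbound.trans (mul_le_mul_of_nonneg_left ?_ hB0)
  have hle : ∀ i : ℕ, (ht (γ i) : ℝ) / K ≤ i := by
    have : ∀ i : ℕ, ht (γ i) ≤ i * K := by
      intro i
      induction i with
      | zero => simp [h0, height_one hht]
      | succ i ih =>
        have h1 := hht (γ i) ((γ i)⁻¹ * γ (i + 1))
        rw [mul_inv_cancel_left] at h1
        have h2 := le_abs_self (ht ((γ i)⁻¹ * γ (i + 1)))
        have h3 := hKS _ (hγ i)
        push_cast
        linarith
    intro i
    rw [div_le_iff₀ (by positivity)]
    exact_mod_cast this i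
  calc ∑ i ∈ Finset.range (wordDist S 1 w), (‖lam‖ ^ K) ^ ((ht (γ i) : ℝ) / K)
      ≤ ∑ i ∈ Finset.range (wordDist S 1 w), (‖lam‖ ^ K) ^ (i : ℝ) :=
        Finset.sum_le_sum fun i _ => Real.rpow_le_rpow_of_exponent_le hR (hle i)
    _ ≤ ∑ i ∈ Finset.range M, (‖lam‖ ^ K) ^ (i : ℝ) :=
        Finset.sum_le_sum_of_subset_of_nonneg (Finset.range_mono hw) fun i _ _ => by positivity

variable {mu : ℂ} {Ψ : G → ℂ}

/-- Elements whose height is small and whose two cocycles have sizes `‖lam‖ ^ (K * m)` and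
`‖mu‖ ^ (K * m)` have length at least `4 * m - L`. -/
theorem exists_forall_wordDist_ge (hlam : 1 < ‖lam‖) (hmu : 1 < ‖mu‖)
    (hht : ∀ g h, ht (g * h) = ht g + ht h)
    (hΦ : ∀ g h, Φ (g * h) = Φ g + lam ^ ht g * Φ h)
    (hΨ : ∀ g h, Ψ (g * h) = Ψ g + mu ^ (-ht g) * Ψ h) {S : Set G}
    (hgen : Subgroup.closure S = ⊤) {K : ℕ} (hK : 0 < K)
    (hKS : ∀ s ∈ insert 1 (S ∪ S⁻¹), |ht s| ≤ K) {B : ℝ} (hB0 : 0 < B)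
    (hBΦ : ∀ s ∈ insert 1 (S ∪ S⁻¹), ‖Φ s‖ ≤ B) (hBΨ : ∀ s ∈ insert 1 (S ∪ S⁻¹), ‖Ψ s‖ ≤ B)
    {c c' : ℝ} (hc : 0 < c) (hc' : 0 < c') :
    ∃ L : ℝ, ∀ (m : ℕ) (v : G), |ht v| ≤ K → c * (‖lam‖ ^ K) ^ m ≤ ‖Φ v‖ →
      c' * (‖mu‖ ^ K) ^ m ≤ ‖Ψ v‖ → 4 * m - L ≤ wordDist S 1 v := by
  obtain ⟨L, hL⟩ := exists_forall_length_ge (one_lt_pow₀ hlam hK.ne') (one_lt_pow₀ hmu hK.ne')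
    (div_pos hc hB0) (div_pos hc' hB0)
  have hK0 : (0 : ℝ) < K := by positivity
  refine ⟨L, fun m v hv hvΦ hvΨ => ?_⟩
  obtain ⟨γ, h0, hγv, hγ⟩ := exists_path hgen v
  have h1 := norm_cocycle_le_sum hlam hht hΦ hK hBΦ h0 hγ (wordDist S 1 v)
  have h2 := norm_cocycle_le_sum (ht := fun g => -ht g) hmu
    (fun g h => by rw [hht]; ring) hΨ hK hBΨ h0 hγ (wordDist S 1 v)
  rw [hγv] at h1 h2
  refine hL (fun i => (ht (γ i) : ℝ) / K) _ m (fun i => ?_) (by simp [h0, height_one hht]) ?_ ?_ ?_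
  · have h3 := hht (γ i) ((γ i)⁻¹ * γ (i + 1))
    rw [mul_inv_cancel_left] at h3
    have h4 : |((ht ((γ i)⁻¹ * γ (i + 1)) : ℤ) : ℝ)| ≤ K := by exact_mod_cast hKS _ (hγ i)
    rw [← sub_div, h3, Int.cast_add, add_sub_cancel_left, abs_div, abs_of_pos hK0]
    exact (div_le_one hK0).2 h4
  · simp only [hγv]
    rw [abs_div, abs_of_pos hK0, div_le_one hK0]
    exact_mod_cast hv
  · rw [Real.rpow_natCast, div_mul_eq_mul_div, div_le_iff₀' hB0]
    exact hvΦ.trans h1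
  · rw [Real.rpow_natCast, div_mul_eq_mul_div, div_le_iff₀' hB0]
    simp only [Int.cast_neg, neg_div] at h2
    exact hvΨ.trans h2

/-- A group with a height function to `ℤ` whose kernel is commutative and with a cocycle expanding
in each of the two directions is not almost convex. -/
theorem not_isAlmostConvex_of_cocycles (hlam : 1 < ‖lam‖) (hmu : 1 < ‖mu‖)
    (hht : ∀ g h, ht (g * h) = ht g + ht h) (hht0 : ∃ g, ht g ≠ 0)
    (hcomm : ∀ g h, ht g = 0 → ht h = 0 → g * h = h * g)
    (hΦ : ∀ g h, Φ (g * h) = Φ g + lam ^ ht g * Φ h)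
    (hΨ : ∀ g h, Ψ (g * h) = Ψ g + mu ^ (-ht g) * Ψ h)
    (ha : ∃ a, ht a = 0 ∧ Φ a ≠ 0) (hb : ∃ b, ht b = 0 ∧ Ψ b ≠ 0)
    {S : Set G} (hfin : S.Finite) (hgen : Subgroup.closure S = ⊤) : ¬ IsAlmostConvex S := by
  obtain ⟨a, ha, hΦa⟩ := ha
  obtain ⟨b, hb, hΨb⟩ := hb
  have hTfin : (insert 1 (S ∪ S⁻¹)).Finite := (hfin.union hfin.inv).insert 1
  obtain ⟨t, ht1, K, hK, htK, hKS⟩ : ∃ t, wordDist S 1 t ≤ 1 ∧ ∃ K : ℕ, 0 < K ∧ ht t = K ∧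
      ∀ s ∈ insert 1 (S ∪ S⁻¹), |ht s| ≤ K := by
    obtain ⟨t, htT, htmax⟩ := Set.exists_max_image _ ht hTfin ⟨1, by simp⟩
    have hbd : ∀ s ∈ insert 1 (S ∪ S⁻¹), |ht s| ≤ ht t := by
      intro s hs
      refine abs_le'.2 ⟨htmax s hs, ?_⟩
      rw [← height_inv hht]
      refine htmax _ ?_
      simpa [or_comm] using hs
    have h0 : 0 ≤ ht t := (abs_nonneg _).trans (hbd t htT)
    have hpos : 0 < ht t := by
      -- If the maximum were 0, all generators would lie in the kernel of the height, which would
      -- then vanish.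
      refine h0.lt_of_ne fun h => ?_
      obtain ⟨g, hg⟩ := hht0
      let f : G →* Multiplicative ℤ := MonoidHom.mk' (fun g => Multiplicative.ofAdd (ht g))
        fun g h => by rw [hht]; rfl
      have hle : Subgroup.closure S ≤ f.ker := (Subgroup.closure_le _).2 fun s hs => by
        have := hbd s (Or.inr (Or.inl hs))
        rw [← h] at this
        exact congrArg Multiplicative.ofAdd (abs_nonpos_iff.1 this)
      rw [hgen] at hle
      exact hg (congrArg Multiplicative.toAdd (hle (Subgroup.mem_top g)))
    refine ⟨t, ?_, (ht t).toNat, by omega, by omega, fun s hs => ?_⟩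
    · rcases htT with rfl | htT | htT
      · simp [wordDist]
      · exact wordDist_one_le_one htT
      · rw [← wordDist_one_inv hgen]
        exact wordDist_one_le_one htT
    · rw [Int.toNat_of_nonneg h0]
      exact hbd s hs
  obtain ⟨B, hB0, hBΦ, hBΨ⟩ : ∃ B : ℝ, 0 < B ∧ (∀ s ∈ insert 1 (S ∪ S⁻¹), ‖Φ s‖ ≤ B) ∧
      ∀ s ∈ insert 1 (S ∪ S⁻¹), ‖Ψ s‖ ≤ B := by
    obtain ⟨s₁, -, h₁⟩ := Set.exists_max_image _ (fun s => ‖Φ s‖) hTfin ⟨1, by simp⟩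
    obtain ⟨s₂, -, h₂⟩ := Set.exists_max_image _ (fun s => ‖Ψ s‖) hTfin ⟨1, by simp⟩
    refine ⟨1 + ‖Φ s₁‖ + ‖Ψ s₂‖, by positivity, fun s hs => ?_, fun s hs => ?_⟩
    · linarith [h₁ s hs, norm_nonneg (Ψ s₂)]
    · linarith [h₂ s hs, norm_nonneg (Φ s₁)]
  have hnht : ∀ g h : G, -ht (g * h) = -ht g + -ht h := fun g h => by rw [hht]; ring
  obtain ⟨L, hL⟩ := exists_forall_wordDist_ge hlam hmu hht hΦ hΨ hgen hK hKS hB0 hBΦ hBΨ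
    (half_pos (norm_pos_iff.2 hΦa)) (half_pos (norm_pos_iff.2 hΨb))
  set c₀ := wordDist S 1 a + wordDist S 1 b with hc₀
  -- `j` is fixed before `M`, and `m` is chosen last, in terms of both.
  obtain ⟨j, hj⟩ := exists_nat_gt (L + c₀)
  intro hAC
  obtain ⟨M, -, hM⟩ := hAC (2 * j)
  obtain ⟨P₁, hP₁⟩ := exists_norm_cocycle_le hlam hht hΦ hgen hK hKS hB0.le hBΦ (j + M)
  obtain ⟨P₂, hP₂⟩ := exists_norm_cocycle_le (ht := fun g => -ht g) hmu hnht hΨ hgen hK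
    (by simpa using hKS) hB0.le hBΨ (j + M)
  obtain ⟨m₁, hm₁⟩ := exists_norm_cocycle_ge hlam hht hΦ hK htK ha hb hΦa P₁
  -- `Ψ` is a cocycle for the negated height, so `t⁻¹` plays the part of `t` and `a`, `b` change
  -- places.
  obtain ⟨m₂, hm₂⟩ := exists_norm_cocycle_ge (ht := fun g => -ht g) (t := t⁻¹) (a := b) (b := a)
    hmu hnht hΨ hK (by rw [height_inv hht, neg_neg, htK]) (by simpa using hb) (by simpa using ha)
    hΨb P₂
  obtain ⟨m, hmj, hmm₁, hmm₂⟩ : ∃ m, j ≤ m ∧ m₁ ≤ m ∧ m₂ ≤ m :=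
    ⟨j + m₁ + m₂, by omega, by omega, by omega⟩
  set x := t ^ m * a * (t ^ m)⁻¹ with hx
  set y := (t ^ m)⁻¹ * b * t ^ m with hy
  have hx0 : ht x = 0 := by rw [hx, hht, hht, height_inv hht, ha]; ring
  have hy0 : ht y = 0 := by rw [hy, hht, hht, height_inv hht, hb]; ring
  have hxy : x * y = y * x := hcomm _ _ hx0 hy0
  have hg0 : ht (x * y) = 0 := by rw [hht, hx0, hy0, add_zero]
  have hlower : ∀ w, wordDist S 1 w ≤ j + M → |ht (x * y * w)| ≤ K →
      4 * m - j + c₀ < wordDist S 1 (x * y * w) := by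
    intro w hw hv
    have h1 := hm₁ m hmm₁ w (hP₁ w hw)
    have h2 := hm₂ m hmm₂ w (hP₂ w hw)
    rw [inv_pow, inv_inv] at h2
    rw [← hx, ← hy] at h1
    rw [← hx, ← hy, ← hxy] at h2
    have h3 := hL m _ hv h1 h2
    have h4 : (4 * m + c₀ : ℝ) < wordDist S 1 (x * y * w) + j := by linarith
    have h5 : 4 * m + c₀ < wordDist S 1 (x * y * w) + j := by exact_mod_cast h4
    omega
  have hpow := fun k => wordDist_one_pow_le hgen ht1 k
  have hpow' : ∀ k, wordDist S 1 ((t ^ k)⁻¹) ≤ k := fun k =>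
    (wordDist_one_inv hgen _).trans_le (hpow k)
  have hxm : wordDist S 1 x ≤ 2 * m + wordDist S 1 a := by
    have h1 := wordDist_one_mul_le hgen (t ^ m * a) (t ^ m)⁻¹
    have := wordDist_one_mul_le hgen (t ^ m) a
    have := hpow m
    have := hpow' m
    rw [← hx] at h1
    omega
  have hym : wordDist S 1 y ≤ 2 * m + wordDist S 1 b := by
    have h1 := wordDist_one_mul_le hgen ((t ^ m)⁻¹ * b) (t ^ m)
    have := wordDist_one_mul_le hgen (t ^ m)⁻¹ b
    have := hpow m
    have := hpow' m
    rw [← hy] at h1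
    omega
  have hup : wordDist S 1 (x * y * t ^ j) ≤ 4 * m - j + c₀ := by
    have e : x * y * t ^ j = y * (t ^ m * a * (t ^ (m - j))⁻¹) := by
      rw [hxy, mul_assoc, hx, mul_assoc (t ^ m * a), pow_sub t hmj]
      group
    rw [e]
    have := wordDist_one_mul_le hgen y (t ^ m * a * (t ^ (m - j))⁻¹)
    have := wordDist_one_mul_le hgen (t ^ m * a) (t ^ (m - j))⁻¹
    have := wordDist_one_mul_le hgen (t ^ m) a
    have := hpow m
    have := hpow' (m - j)
    omega
  have hdown : wordDist S 1 (x * y * t⁻¹ ^ j) ≤ 4 * m - j + c₀ := by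
    have e : x * y * t⁻¹ ^ j = x * ((t ^ m)⁻¹ * b * t ^ (m - j)) := by
      rw [mul_assoc, hy, mul_assoc _ (t ^ m), pow_sub t hmj, inv_pow]
    rw [e]
    have := wordDist_one_mul_le hgen x ((t ^ m)⁻¹ * b * t ^ (m - j))
    have := wordDist_one_mul_le hgen ((t ^ m)⁻¹ * b) (t ^ (m - j))
    have := wordDist_one_mul_le hgen (t ^ m)⁻¹ b
    have := hpow' m
    have := hpow (m - j)
    omega
  have hstart : 4 * m - j + c₀ < wordDist S 1 (x * y) := by
    have := hlower 1 (by simp [wordDist]) (by simp [hg0])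
    rwa [mul_one] at this
  have sphere : ∀ r : G, wordDist S 1 r ≤ 1 → wordDist S 1 (x * y * r ^ j) ≤ 4 * m - j + c₀ →
      ∃ i, 0 < i ∧ i ≤ j ∧ wordDist S 1 (x * y * r ^ i) = 4 * m - j + c₀ := by
    intro r hr hrj
    refine exists_pos_le_eq_of_step (f := fun i => wordDist S 1 (x * y * r ^ i)) (by simpa using hstart)
      hrj fun i => ?_
    have := wordDist_one_mul_le hgen (x * y * r ^ (i + 1)) r⁻¹
    rw [wordDist_one_inv hgen, pow_succ, ← mul_assoc, mul_inv_cancel_right] at this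
    simp only [pow_succ, ← mul_assoc] at this ⊢
    omega
  have ht1' : wordDist S 1 t⁻¹ ≤ 1 := (wordDist_one_inv hgen _).trans_le ht1
  obtain ⟨i₁, hi₁, hi₁j, hs₁⟩ := sphere t ht1 hup
  obtain ⟨i₂, hi₂, hi₂j, hs₂⟩ := sphere t⁻¹ ht1' hdown
  have hdist : wordDist S (x * y * t ^ i₁) (x * y * t⁻¹ ^ i₂) ≤ 2 * j := by
    have h1 := wordDist_one_mul_le hgen (t ^ i₁)⁻¹ (t⁻¹ ^ i₂)
    have h2 := hpow' i₁
    have h3 := wordDist_one_pow_le hgen ht1' i₂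
    rw [wordDist_mul_left hgen, wordDist_eq_one_left hgen]
    omega
  obtain ⟨p, hpM, hpball⟩ := hM _ _ hs₁ _ hs₂ hdist
  -- The walk goes from positive to negative height in steps of at most `K`, so it cannot jump over
  -- the window `[-K, K]`.
  obtain ⟨i, hi⟩ := exists_abs_le_of_step (f := fun i => ht (p.getVert i)) (n := p.length) (K := K)
    (by
      rw [p.getVert_zero, hht, hg0, height_pow hht, htK, zero_add]
      positivity)
    (by
      rw [p.getVert_length, hht, hg0, height_pow hht, height_inv hht, htK, zero_add, mul_neg,
        neg_lt_zero]
      positivity)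
    (fun i => by
      have h1 := hht (p.getVert i) ((p.getVert i)⁻¹ * p.getVert (i + 1))
      rw [mul_inv_cancel_left] at h1
      rw [h1, add_sub_cancel_left]
      exact hKS _ (walk_step_mem p i))
  have hball : wordDist S 1 (p.getVert i) ≤ 4 * m - j + c₀ := hpball _ (p.getVert_mem_support i)
  have hnear : wordDist S 1 ((x * y)⁻¹ * p.getVert i) ≤ j + M := by
    rw [← wordDist_eq_one_left hgen]
    have h1 := wordDist_triangle hgen (x * y) (x * y * t ^ i₁) (p.getVert i)
    rw [wordDist_eq_one_left hgen (x * y) (_ * _), inv_mul_cancel_left] at h1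
    have h2 := hpow i₁
    have h3 := wordDist_getVert_le p i
    omega
  have := hlower _ hnear (by rwa [mul_inv_cancel_left])
  rw [mul_inv_cancel_left] at this
  omega

end Cocycle

/-! ### Eigenvalues and left eigenvectors -/

theorem exists_vecMul_eq_smul_of_isRoot {n : Type*} [Fintype n] [DecidableEq n]
    {M : Matrix n n ℂ} {z : ℂ} (hz : M.charpoly.IsRoot z) :
    ∃ v ≠ 0, Matrix.vecMul v M = z • v := by
  rw [Polynomial.IsRoot, Matrix.eval_charpoly] at hz
  obtain ⟨v, hv, h⟩ := Matrix.exists_vecMul_eq_zero_iff.2 hz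
  refine ⟨v, hv, ?_⟩
  rw [Matrix.vecMul_sub, sub_eq_zero] at h
  rw [← h]
  ext i
  simp [Matrix.vecMul_diagonal, mul_comm]

/-- Were all norms on one side of 1, the factor `z` with `‖z‖ ≠ 1` would move the product strictly
off 1. -/
theorem exists_root_norm_gt_one_and_lt_one {s : Multiset ℂ} (hs : ‖s.prod‖ = 1)
    (h : ∃ z ∈ s, ‖z‖ ≠ 1) : (∃ z ∈ s, 1 < ‖z‖) ∧ ∃ z ∈ s, ‖z‖ < 1 := by
  obtain ⟨z, hz, hz1⟩ := h
  have h0 : ∀ w ∈ s, 0 < ‖w‖ := fun w hw => norm_pos_iff.2 fun h => by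
    rw [Multiset.prod_eq_zero (h ▸ hw)] at hs
    simp at hs
  obtain ⟨r, rfl⟩ := Multiset.exists_cons_of_mem hz
  have hprod : ‖z‖ * (r.map fun w => ‖w‖).prod = 1 := by
    rw [Multiset.prod_cons, norm_mul] at hs
    rw [← hs]
    congr 1
    exact (map_multiset_prod (normHom (α := ℂ)) r).symm
  have hr0 : ∀ w ∈ r, 0 < ‖w‖ := fun w hw => h0 w (Multiset.mem_cons_of_mem hw)
  constructor
  · by_contra! hle
    have h1 : (r.map fun w => ‖w‖).prod ≤ (r.map fun _ => (1 : ℝ)).prod :=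
      Multiset.prod_map_le_prod_map₀ _ _ (fun w hw => (hr0 w hw).le)
        fun w hw => hle w (Multiset.mem_cons_of_mem hw)
    have h2 : ‖z‖ < 1 := (hle z hz).lt_of_ne hz1
    simp only [Multiset.map_const', Multiset.prod_replicate, one_pow] at h1
    nlinarith [h0 z hz]
  · by_contra! hle
    have h1 : (r.map fun _ => (1 : ℝ)).prod ≤ (r.map fun w => ‖w‖).prod :=
      Multiset.prod_map_le_prod_map₀ _ _ (fun w hw => zero_le_one)
        fun w hw => hle w (Multiset.mem_cons_of_mem hw)
    have h2 : 1 < ‖z‖ := (hle z hz).lt_of_ne' hz1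
    simp only [Multiset.map_const', Multiset.prod_replicate, one_pow] at h1
    nlinarith

/-! ### The cocycles on the torus bundle group -/

section TorusBundle

variable {N : ℕ} {A : Matrix.SpecialLinearGroup (Fin N) ℤ}

/-- The linear functional on `ℤ^N` with coefficients `v`, applied to the lattice part of an element
of the torus bundle group. -/
noncomputable def latticeFunctional (A : Matrix.SpecialLinearGroup (Fin N) ℤ) (v : Fin N → ℂ)
    (g : TorusBundleGroup A) : ℂ :=
  ∑ i, v i * ((Multiplicative.toAdd g.left i : ℤ) : ℂ)

/-- The exponent of the generator of the factor `ℤ`. -/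
def fiberHeight (g : TorusBundleGroup A) : ℤ :=
  Multiplicative.toAdd g.right

theorem fiberHeight_mul (g h : TorusBundleGroup A) :
    fiberHeight (g * h) = fiberHeight g + fiberHeight h :=
  rfl

theorem sum_latticeAut_apply {v : Fin N → ℂ} {z : ℂ}
    (hv : Matrix.vecMul v ((A : Matrix (Fin N) (Fin N) ℤ).map (Int.cast : ℤ → ℂ)) = z • v)
    (x : Multiplicative (Fin N → ℤ)) :
    ∑ i, v i * ((Multiplicative.toAdd (latticeAut A x) i : ℤ) : ℂ) =
      z * ∑ i, v i * ((Multiplicative.toAdd x i : ℤ) : ℂ) := by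
  have h1 : ∀ i, ((Multiplicative.toAdd (latticeAut A x) i : ℤ) : ℂ) =
      Matrix.mulVec ((A : Matrix (Fin N) (Fin N) ℤ).map (Int.cast : ℤ → ℂ))
        (fun i => ((Multiplicative.toAdd x i : ℤ) : ℂ)) i := fun i => by
    change (((Matrix.toLin' (A : Matrix (Fin N) (Fin N) ℤ)) (Multiplicative.toAdd x) i : ℤ) : ℂ) = _
    simp [Matrix.mulVec, dotProduct]
  have h2 := Matrix.dotProduct_mulVec v
    ((A : Matrix (Fin N) (Fin N) ℤ).map (Int.cast : ℤ → ℂ))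
    (fun i => ((Multiplicative.toAdd x i : ℤ) : ℂ))
  rw [hv, smul_dotProduct, smul_eq_mul] at h2
  simp only [h1]
  exact h2

theorem sum_latticeAut_zpow_apply {v : Fin N → ℂ} {z : ℂ} (hz : z ≠ 0)
    (hv : Matrix.vecMul v ((A : Matrix (Fin N) (Fin N) ℤ).map (Int.cast : ℤ → ℂ)) = z • v)
    (m : ℤ) (x : Multiplicative (Fin N → ℤ)) :
    ∑ i, v i * ((Multiplicative.toAdd ((latticeAut A ^ m) x) i : ℤ) : ℂ) =
      z ^ m * ∑ i, v i * ((Multiplicative.toAdd x i : ℤ) : ℂ) := by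
  induction m using Int.induction_on generalizing x with
  | zero => simp
  | succ m ih =>
    rw [zpow_add_one, MulAut.mul_apply, ih, sum_latticeAut_apply hv, zpow_add_one₀ hz, mul_assoc]
  | pred m ih =>
    rw [zpow_sub_one, MulAut.mul_apply, ih, zpow_sub_one₀ hz, mul_assoc]
    congr 1
    rw [eq_inv_mul_iff_mul_eq₀ hz, ← sum_latticeAut_apply hv, MulAut.apply_inv_self]

/-- The action of `g` on the lattice part of `h` is by a power of `A`, which a left eigenvector
turns into a scalar. -/
theorem latticeFunctional_mul {v : Fin N → ℂ} {z : ℂ} (hz : z ≠ 0)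
    (hv : Matrix.vecMul v ((A : Matrix (Fin N) (Fin N) ℤ).map (Int.cast : ℤ → ℂ)) = z • v)
    (g h : TorusBundleGroup A) :
    latticeFunctional A v (g * h) =
      latticeFunctional A v g + z ^ fiberHeight g * latticeFunctional A v h := by
  have key := sum_latticeAut_zpow_apply hz hv (fiberHeight g) h.left
  rw [latticeFunctional, latticeFunctional, latticeFunctional, ← key, ← Finset.sum_add_distrib]
  refine Finset.sum_congr rfl fun i _ => ?_
  rw [SemidirectProduct.mul_left, zpowersHom_apply, toAdd_mul, Pi.add_apply, Int.cast_add, mul_add]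
  rfl

theorem exists_latticeFunctional_ne_zero {v : Fin N → ℂ} (hv : v ≠ 0) :
    ∃ a : TorusBundleGroup A, fiberHeight a = 0 ∧ latticeFunctional A v a ≠ 0 := by
  obtain ⟨i, hi⟩ := Function.ne_iff.1 hv
  refine ⟨SemidirectProduct.inl (Multiplicative.ofAdd (Pi.single i 1)), rfl, ?_⟩
  simpa [latticeFunctional, Pi.single_apply] using hi

theorem mul_comm_of_fiberHeight_eq_zero (g h : TorusBundleGroup A) (hg : fiberHeight g = 0)
    (hh : fiberHeight h = 0) : g * h = h * g := by
  have hg' : g.right = 1 := hg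
  have hh' : h.right = 1 := hh
  ext1
  · simp [SemidirectProduct.mul_left, hg', hh', mul_comm]
  · simp [hg', hh']

end TorusBundle

theorem theorem1p2 {N : ℕ} (A : Matrix.SpecialLinearGroup (Fin N) ℤ)
    (hA : ∃ z : ℂ, Module.End.HasEigenvalue
      (Matrix.toLin' ((A : Matrix (Fin N) (Fin N) ℤ).map (Int.cast : ℤ → ℂ))) z ∧ ‖z‖ ≠ 1)
    (S : Set (TorusBundleGroup A)) (hfin : S.Finite) (hgen : Subgroup.closure S = ⊤) :
    ¬ IsAlmostConvex S := by
  set M := (A : Matrix (Fin N) (Fin N) ℤ).map (Int.cast : ℤ → ℂ) with hM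
  have hdet : M.det = 1 := by
    have := Int.cast_det (R := ℂ) (A : Matrix (Fin N) (Fin N) ℤ)
    rw [A.det_coe, Int.cast_one] at this
    exact this.symm
  have hmem : ∀ z, z ∈ M.charpoly.roots ↔ M.charpoly.IsRoot z := fun z =>
    Polynomial.mem_roots M.charpoly_monic.ne_zero
  obtain ⟨⟨lam, hlam, hlam1⟩, ⟨mu, hmu, hmu1⟩⟩ :=
    exists_root_norm_gt_one_and_lt_one (s := M.charpoly.roots)
      (by rw [← Matrix.det_eq_prod_roots_charpoly, hdet, norm_one]) (by
        obtain ⟨z, hz, hz1⟩ := hA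
        refine ⟨z, (hmem z).2 ?_, hz1⟩
        rw [← Matrix.mem_spectrum_iff_isRoot_charpoly, ← Matrix.spectrum_toLin']
        exact hz.mem_spectrum)
  have hmu0 : mu ≠ 0 := by
    rintro rfl
    rw [Matrix.det_eq_prod_roots_charpoly, Multiset.prod_eq_zero hmu] at hdet
    exact zero_ne_one hdet
  have hlam0 : lam ≠ 0 := norm_pos_iff.1 (by linarith)
  obtain ⟨v, hv, hvA⟩ := exists_vecMul_eq_smul_of_isRoot ((hmem _).1 hlam)
  obtain ⟨w, hw, hwA⟩ := exists_vecMul_eq_smul_of_isRoot ((hmem _).1 hmu)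
  -- The inverse of `mu` has norm above 1, and its power `-fiberHeight g` is `mu ^ fiberHeight g`.
  refine not_isAlmostConvex_of_cocycles (lam := lam) (mu := mu⁻¹) hlam1 ?_ fiberHeight_mul
    ⟨SemidirectProduct.inr (Multiplicative.ofAdd 1), one_ne_zero⟩ mul_comm_of_fiberHeight_eq_zero
    (latticeFunctional_mul hlam0 hvA) (fun g h => ?_) (exists_latticeFunctional_ne_zero hv)
    (exists_latticeFunctional_ne_zero hw) hfin hgen
  · rw [norm_inv]
    exact one_lt_inv_iff₀.2 ⟨norm_pos_iff.2 hmu0, hmu1⟩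
  · rw [inv_zpow', neg_neg]
    exact latticeFunctional_mul hmu0 hwA g h
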